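/- Let $\Gamma=(V,E)$ be a connected finite simple graph with $n$ vertices, let $v\in V$, and let $\Gamma_v$ be the graph obtained from $\Gamma$ by deleting $v$ and all edges incident to $v$. Let $W_v=(\mathbb{C}^2)^{\otimes (V\setminus\{v\})}$, a Hilbert space of dimension $2^{n-1}$, and for $w\in V\setminus\{v\}$ let $X_w, Z_w$ be the Pauli operators acting on the tensor factor $w$ of $W_v$. Consider the following real Lie algebras of operators on $W_v$, generated under the commutator: - the free dynamical Lie algebra (DLA) of $\Gamma_v$, $$\mathfrak g_{\Gamma_v,\mathrm{free}}=\big\langle \{iX_w : w\in V\setminus\{v\}\},\ \{iZ_wZ_{w'} : \{w,w'\}\in E(\Gamma_v)\}\big\rangle_{\mathrm{Lie}};$$ - the free reduced DLA, $$\mathfrak g^{v}_{\Gamma,\mathrm{free}}=\big\langle \{iX_w : w\in V\setminus\{v\}\},\ \{iZ_wZ_{w'} : \{w,w'\}\in E(\Gamma_v)\},\ \{iZ_w : \{v,w\}\in E\}\big\rangle_{\mathrm{Lie}};$$ - the standard reduced DLA, $$\mathfrak g^{v}_{\Gamma,\mathrm{std}}=\Big\langle\, i\!\!\sum_{w\in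 V\setminus\{v\}}\!\! X_w,\ \ i\Big(\sum_{\{w,w'\}\in E(\Gamma_v)} Z_wZ_{w'}+\sum_{\{v,w\}\in E} Z_w\Big)\Big\rangle_{\mathrm{Lie}}.$$ Suppose that $\Gamma_v$ is connected and is neither bipartite nor a cycle, and that $\mathfrak g_{\Gamma_v,\mathrm{free}}\subseteq \mathfrak g^{v}_{\Gamma,\mathrm{std}}$. Then $$\mathfrak g^{v}_{\Gamma,\mathrm{std}}=\mathfrak g^{v}_{\Gamma,\mathrm{free}},$$ and $\mathfrak g^{v}_{\Gamma,\mathrm{std}}$ is isomorphic, as a real Lie algebra, to $\mathfrak{su}(W_v)\cong\mathfrak{su}(2^{n-1})$, where $\mathfrak{su}(W_v)$ is the Lie algebra of traceless skew-Hermitian operators on $W_v$. -/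

import Mathlib

attribute [local instance 100] LieRing.ofAssociativeRing

/-- The Lie algebra `su(ι)`, a real Lie algebra under the commutator: traceless skew-Hermitian
complex matrices with rows and columns indexed by `ι`, that is, traceless skew-Hermitian operators
on the Hilbert space with orthonormal basis indexed by `ι`. -/
def su (ι : Type*) [Fintype ι] [DecidableEq ι] : LieSubalgebra ℝ (Matrix ι ι ℂ) where
  carrier := {A | A.conjTranspose = -A ∧ A.trace = 0}
  zero_mem' := by simp
  add_mem' := by
    rintro A B ⟨hA, hA'⟩ ⟨hB, hB'⟩
    refine ⟨?_, ?_⟩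
    · rw [Matrix.conjTranspose_add, hA, hB, neg_add]
    · rw [Matrix.trace_add, hA', hB', add_zero]
  smul_mem' := by
    rintro c A ⟨hA, hA'⟩
    refine ⟨?_, ?_⟩
    · rw [Matrix.conjTranspose_smul, hA, star_trivial, smul_neg]
    · rw [Matrix.trace_smul, hA', smul_zero]
  lie_mem' := by
    rintro A B ⟨hA, -⟩ ⟨hB, -⟩
    refine ⟨?_, ?_⟩
    · rw [Ring.lie_def, Matrix.conjTranspose_sub, Matrix.conjTranspose_mul,
        Matrix.conjTranspose_mul, hA, hB]
      simp
    · rw [Ring.lie_def, Matrix.trace_sub, Matrix.trace_mul_comm, sub_self]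

/-- Bit strings on a set `U` of qubits; they label the computational basis of `(ℂ²)^{⊗ U}`. -/
abbrev BitString (U : Type*) := U → Fin 2

/-- Linear operators on the Hilbert space `(ℂ²)^{⊗ U}`, written as matrices in the
computational basis. -/
abbrev QubitOp (U : Type*) := Matrix (BitString U) (BitString U) ℂ

section Pauli

variable {U : Type*} [Fintype U] [DecidableEq U]

/-- The single-qubit operator `A` acting on the tensor factor `w`, tensored with the identity on
all the other factors. -/
noncomputable def onQubit (w : U) (A : Matrix (Fin 2) (Fin 2) ℂ) : QubitOp U :=
  Matrix.of fun x y => if ∀ u, u ≠ w → x u = y u then A (x w) (y w) else 0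

/-- The Pauli operator `X_w`. -/
noncomputable def pauliX (w : U) : QubitOp U := onQubit w !![0, 1; 1, 0]

/-- The Pauli operator `Z_w`. -/
noncomputable def pauliZ (w : U) : QubitOp U := onQubit w !![1, 0; 0, -1]

theorem pauliZ_eq_diagonal (w : U) :
    pauliZ w = Matrix.diagonal (fun x : BitString U => if x w = 0 then (1 : ℂ) else -1) := by
  ext x y
  by_cases h : x = y
  · subst h
    have hx : x w = 0 ∨ x w = 1 := by omega
    rcases hx with hx | hx <;> simp [pauliZ, onQubit, hx]
  · rw [Matrix.diagonal_apply_ne _ h]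
    simp only [pauliZ, onQubit, Matrix.of_apply]
    split_ifs with h'
    · have hw : x w ≠ y w := by
        intro hw
        refine h (funext fun u => ?_)
        by_cases hu : u = w
        · rw [hu, hw]
        · exact h' u hu
      have hx : x w = 0 ∨ x w = 1 := by omega
      have hy : y w = 0 ∨ y w = 1 := by omega
      rcases hx with hx | hx <;> rcases hy with hy | hy <;> simp_all
    · rfl

theorem pauliZ_mul_comm (w w' : U) : pauliZ w * pauliZ w' = pauliZ w' * pauliZ w := by
  rw [pauliZ_eq_diagonal, pauliZ_eq_diagonal, Matrix.diagonal_mul_diagonal,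
    Matrix.diagonal_mul_diagonal]
  simp only [mul_comm]

/-- The operator `Z_w Z_{w'}` attached to an unordered pair `{w, w'}`. -/
noncomputable def pauliZZ : Sym2 U → QubitOp U :=
  Sym2.lift ⟨fun w w' => pauliZ w * pauliZ w', pauliZ_mul_comm⟩

end Pauli

/-- The free dynamical Lie algebra of MaxCut on the graph `G`: the real Lie algebra generated by
all `i X_w`, for vertices `w`, and all `i Z_w Z_{w'}`, for edges `{w, w'}`. -/
noncomputable def freeDLA {U : Type*} [Fintype U] [DecidableEq U] (G : SimpleGraph U) :
    LieSubalgebra ℝ (QubitOp U) :=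
  LieSubalgebra.lieSpan ℝ (QubitOp U)
    ({A | ∃ w : U, A = Complex.I • pauliX w} ∪
      {A | ∃ e ∈ G.edgeSet, A = Complex.I • pauliZZ e})

/-- The reduced graph `G_v`: the vertex `v` is removed together with all its edges. -/
abbrev reducedGraph {V : Type*} (G : SimpleGraph V) (v : V) : SimpleGraph {w : V // w ≠ v} :=
  G.comap Subtype.val

section Reduced

variable {V : Type*} [Fintype V] [DecidableEq V]

/-- The reduced mixer Hamiltonian, the sum of all `X_w` with `w ≠ v`, acting on the reduced
Hilbert space `W_v = (ℂ²)^{⊗ (V \ {v})}`. -/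
noncomputable def reducedMixer (v : V) : QubitOp {w : V // w ≠ v} := ∑ w : {w : V // w ≠ v}, pauliX w

/-- The reduced problem Hamiltonian of MaxCut on `G`: the sum of `Z_w Z_{w'}` over the edges of `G`
that avoid `v`, plus the sum of `Z_w` over the neighbours `w` of `v`. -/
noncomputable def reducedProblem (G : SimpleGraph V) [DecidableRel G.Adj] (v : V) : QubitOp {w : V // w ≠ v} :=
  (∑ e ∈ (reducedGraph G v).edgeFinset, pauliZZ e) +
    (∑ w : {w : V // w ≠ v} with G.Adj v w.1, pauliZ w)

/-- The standard reduced dynamical Lie algebra of `G` at `v`. -/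
noncomputable def stdReducedDLA (G : SimpleGraph V) [DecidableRel G.Adj] (v : V) :
    LieSubalgebra ℝ (QubitOp {w : V // w ≠ v}) :=
  LieSubalgebra.lieSpan ℝ (QubitOp {w : V // w ≠ v})
    {Complex.I • reducedMixer v, Complex.I • reducedProblem G v}

/-- The free reduced dynamical Lie algebra of `G` at `v`. -/
noncomputable def freeReducedDLA (G : SimpleGraph V) (v : V) : LieSubalgebra ℝ (QubitOp {w : V // w ≠ v}) :=
  LieSubalgebra.lieSpan ℝ (QubitOp {w : V // w ≠ v})
    ({A | ∃ w : {w : V // w ≠ v}, A = Complex.I • pauliX w} ∪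
      {A | ∃ e ∈ (reducedGraph G v).edgeSet, A = Complex.I • pauliZZ e} ∪
      {A | ∃ w : {w : V // w ≠ v}, G.Adj v w.1 ∧ A = Complex.I • pauliZ w})

end Reduced

/-- `H` is a cycle: it is isomorphic to the cycle graph `C_m` for some `m ≥ 3`. -/
def IsCycleGraph {U : Type*} (H : SimpleGraph U) : Prop :=
  ∃ m : ℕ, 3 ≤ m ∧ Nonempty (H ≃g SimpleGraph.cycleGraph m)

/-!
Label the Pauli string `X^x Z^z` by the pair `(x, z)` of vectors over `ZMod 2`. The labels of the
strings in a Lie algebra containing the free DLA of a connected graph `H` are closed under sums of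
anticommuting labels. If one of them has a single vertex as its `Z`-support, then bracketing with
`Z_w Z_u` moves that vertex along the edges of `H`, and the number of `X`s outside it changes parity
with each step. Carrying it once around an odd cycle therefore yields a pure `X`-string of even
weight, and one that misses some vertex. Pure `X`-strings may be permuted by vertex swaps, so such a
string generates all `X`-translations of the labels over that single vertex. From there every
nonzero label is reached. The skew-Hermitian Pauli strings span the skew-Hermitian operators over
the reals, and those with nonzero label the traceless ones, which is `su`.
-/

open scoped Matrix

section OddCycle

variable {U : Type*} {H : SimpleGraph U}

theorem even_length_bypass_iff_of_forall_isCycle [DecidableEq U]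
    (hH : ∀ (c : U) (q : H.Walk c c), q.IsCycle → Even q.length) {u v : U} (p : H.Walk u v) :
    Even p.bypass.length ↔ Even p.length := by
  induction p with
  | nil => rfl
  | @cons u w v h p ih =>
    rw [SimpleGraph.Walk.bypass, SimpleGraph.Walk.length_cons, Nat.even_add_one, ← ih]
    split_ifs with hu
    · set t := p.bypass.takeUntil u hu with ht
      have ht_path : t.IsPath := p.bypass_isPath.takeUntil hu
      have ht_odd : ¬ Even t.length := by
        by_cases hedge : s(u, w) ∈ t.edges
        · rw [ht_path.length_eq_one_of_mem_edges (Sym2.eq_swap ▸ hedge)]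
          exact Nat.not_even_one
        · have := hH u (.cons h t) ((t.cons_isCycle_iff h).2 ⟨ht_path, hedge⟩)
          rwa [SimpleGraph.Walk.length_cons, Nat.even_add_one] at this
      have hsplit := congrArg SimpleGraph.Walk.length (p.bypass.take_spec hu)
      rw [SimpleGraph.Walk.length_append] at hsplit
      rw [← hsplit, Nat.even_add]
      tauto
    · rw [SimpleGraph.Walk.length_cons, Nat.even_add_one]

theorem isBipartite_of_forall_isCycle_even_length
    (hH : ∀ (c : U) (q : H.Walk c c), q.IsCycle → Even q.length) : H.IsBipartite := by
  classical
  refine SimpleGraph.two_colorable_iff_forall_loop_even.2 fun u p => ?_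
  have hlength : p.bypass.length = 0 :=
    SimpleGraph.Walk.length_eq_zero_iff.2 (SimpleGraph.Walk.isPath_iff_nil.1 p.bypass_isPath)
  rw [← even_length_bypass_iff_of_forall_isCycle hH p, hlength]
  exact Even.zero

theorem card_support_toFinset_of_isCycle [DecidableEq U] {c : U} {q : H.Walk c c}
    (hq : q.IsCycle) : q.support.toFinset.card = q.length := by
  rw [← q.cons_tail_support, List.toFinset_cons, Finset.insert_eq_of_mem
    (List.mem_toFinset.2 (q.end_mem_tail_support hq.not_nil)),
    List.toFinset_card_of_nodup hq.support_nodup, List.length_tail,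
    SimpleGraph.Walk.length_support, Nat.add_sub_cancel]

end OddCycle

section Labels

theorem zmodTwo_eq_zero_or_one : ∀ a : ZMod 2, a = 0 ∨ a = 1 := by decide

variable {U : Type*}

theorem exists_apply_eq_one {y : U → ZMod 2} (hy : y ≠ 0) : ∃ t, y t = 1 := by
  obtain ⟨t, ht⟩ := Function.ne_iff.1 hy
  exact ⟨t, (zmodTwo_eq_zero_or_one _).resolve_left ht⟩

/-- The `X`-translations that map the labels in `A` with second component `z` to labels in `A`. -/
def fiberStabilizer (A : Set ((U → ZMod 2) × (U → ZMod 2))) (z : U → ZMod 2) :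
    Submodule (ZMod 2) (U → ZMod 2) where
  carrier := {y | ∀ x, (x, z) ∈ A → (x + y, z) ∈ A}
  zero_mem' x hx := by rwa [add_zero]
  add_mem' {y y'} hy hy' x hx := by
    rw [← add_assoc]
    exact hy' _ (hy x hx)
  smul_mem' b y hy x hx := by
    obtain rfl | rfl := zmodTwo_eq_zero_or_one b
    · rwa [zero_smul, add_zero]
    · rw [one_smul]
      exact hy x hx

theorem mem_of_fiberStabilizer_eq_top {A : Set ((U → ZMod 2) × (U → ZMod 2))}
    {x y z : U → ZMod 2} (hz : fiberStabilizer A z = ⊤) (hx : (x, z) ∈ A) : (y, z) ∈ A := by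
  have hmem : x + y ∈ fiberStabilizer A z := hz ▸ Submodule.mem_top
  simpa only [← add_assoc, ZModModule.add_self, zero_add] using hmem x hx

variable [DecidableEq U]

theorem comp_swap_eq_add_single_add_single (x : U → ZMod 2) (i j : U) :
    x ∘ Equiv.swap i j = x + Pi.single i (x i + x j) + Pi.single j (x i + x j) := by
  funext k
  rw [Equiv.comp_swap_eq_update]
  simp only [Function.update_apply, Pi.add_apply, Pi.single_apply]
  split_ifs <;> grind [CharTwo.add_self_eq_zero]

theorem eq_top_of_forall_single_mem [Finite U] {R : Type*} [Semiring R] {E : Submodule R (U → R)}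
    (hE : ∀ i, Pi.single i 1 ∈ E) : E = ⊤ := by
  rw [eq_top_iff, ← (Pi.basisFun R U).span_eq, Submodule.span_le]
  rintro _ ⟨i, rfl⟩
  rw [Pi.basisFun_apply]
  exact hE i

variable [Fintype U]

theorem sum_single_filter_eq_one (z : U → ZMod 2) : ∑ i with z i = 1, Pi.single i 1 = z := by
  rw [Finset.sum_filter]
  conv_rhs => rw [← Finset.univ_sum_single z]
  refine Finset.sum_congr rfl fun i _ => ?_
  obtain hi | hi := zmodTwo_eq_zero_or_one (z i) <;> simp [hi]

/-- A set of labels `(x, z)` of Pauli strings `X^x Z^z` that contains the labels of all `X_w` and of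
all `Z_w Z_u` for edges `{w, u}` of `H` and is closed under sums of anticommuting labels. The
strings `X^x Z^z` and `X^x' Z^z'` anticommute exactly if `x ⬝ᵥ z' + z ⬝ᵥ x' = 1`, and their
commutator is then a multiple of the string labelled by the sum. -/
structure IsPauliClosed (H : SimpleGraph U) (A : Set ((U → ZMod 2) × (U → ZMod 2))) : Prop where
  add_mem : ∀ {x z x' z' : U → ZMod 2}, (x, z) ∈ A → (x', z') ∈ A →
    x ⬝ᵥ z' + z ⬝ᵥ x' = 1 → (x + x', z + z') ∈ A
  x_mem : ∀ w, (Pi.single w 1, 0) ∈ A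
  zz_mem : ∀ {w u}, H.Adj w u → (0, Pi.single w 1 + Pi.single u 1) ∈ A

namespace IsPauliClosed

variable {H : SimpleGraph U} {A : Set ((U → ZMod 2) × (U → ZMod 2))}

theorem add_single_mem (hA : IsPauliClosed H A) {x z : U → ZMod 2} (hx : (x, z) ∈ A) {w : U}
    (hw : z w = 1) (b : ZMod 2) : (x + Pi.single w b, z) ∈ A := by
  obtain rfl | rfl := zmodTwo_eq_zero_or_one b
  · rwa [Pi.single_zero, add_zero]
  · simpa only [add_zero] using hA.add_mem hx (hA.x_mem w) (by simp [hw])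

theorem add_mem_of_fst_mem (hA : IsPauliClosed H A) {x y z : U → ZMod 2} (hx : (x, z) ∈ A)
    (hy : (y, 0) ∈ A) (hzy : z ⬝ᵥ y = 1) : (x + y, z) ∈ A := by
  simpa only [add_zero] using hA.add_mem hx hy (by rw [dotProduct_zero, zero_add, hzy])

theorem add_fst_mem (hA : IsPauliClosed H A) {x y z : U → ZMod 2} (hx : (x, z) ∈ A)
    (hy : (y, z) ∈ A) (hxy : (x + y) ⬝ᵥ z = 1) : (x + y, 0) ∈ A := by
  rw [add_dotProduct, dotProduct_comm y] at hxy
  simpa only [ZModModule.add_self] using hA.add_mem hx hy hxy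

theorem mem_single_of_adj (hA : IsPauliClosed H A) {x : U → ZMod 2} {w u : U}
    (hx : (x, Pi.single w 1) ∈ A) (hwu : H.Adj w u) (hxwu : x w + x u = 1) :
    (x, Pi.single u 1) ∈ A := by
  have hsum := hA.add_mem hx (hA.zz_mem hwu) (by simpa [dotProduct_add] using hxwu)
  rwa [add_zero, ← add_assoc, ZModModule.add_self, zero_add] at hsum

-- Every step of the walk flips the parity `∑ i, x i + x w`.
theorem exists_mem_of_walk (hA : IsPauliClosed H A) {w u : U} (p : H.Walk w u) {x : U → ZMod 2}
    (hx : (x, Pi.single w 1) ∈ A) : ∃ y : U → ZMod 2, (y, Pi.single u 1) ∈ A ∧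
      ∑ i, y i + y u = ∑ i, x i + x w + p.length ∧ ∀ i ∉ p.support, y i = x i := by
  induction p generalizing x with
  | nil => exact ⟨x, hx, by simp, fun _ _ => rfl⟩
  | @cons w v u h p ih =>
    set x' := x + Pi.single w (x w + x v + 1) with hx'
    have hw : x' w = x v + 1 := by
      rw [hx', Pi.add_apply, Pi.single_eq_same, add_assoc, CharTwo.add_cancel_left]
    have hne : ∀ i ≠ w, x' i = x i := fun i hi => by
      rw [hx', Pi.add_apply, Pi.single_eq_of_ne hi, add_zero]
    have hx'v : (x', Pi.single v 1) ∈ A :=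
      hA.mem_single_of_adj (hA.add_single_mem hx (Pi.single_eq_same _ _) _) h (by
        rw [hw, hne v h.ne', add_right_comm, CharTwo.add_self_eq_zero, zero_add])
    obtain ⟨y, hy, hsum, hsupp⟩ := ih hx'v
    refine ⟨y, hy, ?_, fun i hi => ?_⟩
    · have hx'sum : ∑ i, x' i = ∑ i, x i + (x w + x v + 1) := by
        simp only [hx', Pi.add_apply, Finset.sum_add_distrib, Finset.sum_pi_single',
          Finset.mem_univ, if_true]
      rw [hsum, hx'sum, hne v h.ne', SimpleGraph.Walk.length_cons, Nat.cast_add_one]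
      linear_combination CharTwo.add_self_eq_zero (x v)
    · rw [SimpleGraph.Walk.support_cons, List.mem_cons, not_or] at hi
      rw [hsupp i hi.2, hne i hi.1]

theorem exists_even_x_mem (hA : IsPauliClosed H A) {c : U} {p : H.Walk c c} (hp : p.IsCycle)
    (hodd : Odd p.length) {x : U → ZMod 2} (hx : (x, Pi.single c 1) ∈ A) :
    ∃ d : U → ZMod 2, (d, 0) ∈ A ∧ d c = 1 ∧ ∑ i, d i = 0 ∧ ∃ b, d b = 0 := by
  obtain ⟨y, hy, hsum, hsupp⟩ := hA.exists_mem_of_walk p hx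
  rw [ZMod.natCast_eq_one_iff_odd.2 hodd] at hsum
  have hy' := hA.add_single_mem hy (Pi.single_eq_same c 1) (x c + y c + 1)
  set d := x + (y + Pi.single c (x c + y c + 1)) with hd
  have hdc : d c = 1 := by
    simp only [hd, Pi.add_apply, Pi.single_eq_same]
    linear_combination CharTwo.add_self_eq_zero (x c) + CharTwo.add_self_eq_zero (y c)
  have hdsum : ∑ i, d i = 0 := by
    simp only [hd, Pi.add_apply, Finset.sum_add_distrib, Finset.sum_pi_single',
      Finset.mem_univ, if_true]
    linear_combination hsum + CharTwo.add_self_eq_zero (∑ i, x i) +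
      CharTwo.add_self_eq_zero (x c) + CharTwo.add_self_eq_zero (1 : ZMod 2)
  refine ⟨d, hA.add_fst_mem hx hy' (by rwa [dotProduct_single_one]), hdc, hdsum, ?_⟩
  -- If `d` vanished nowhere, then `p` would pass through all vertices, an odd number.
  by_contra! hd_ne
  have hd_one : ∀ i, d i = 1 := fun i => (zmodTwo_eq_zero_or_one _).resolve_left (hd_ne i)
  have huniv : p.support.toFinset = Finset.univ := by
    refine Finset.eq_univ_iff_forall.2 fun i => List.mem_toFinset.2 ?_
    by_contra hi
    have hic : i ≠ c := fun hic => hi (hic ▸ p.start_mem_support)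
    refine hd_ne i ?_
    rw [hd, Pi.add_apply, Pi.add_apply, Pi.single_eq_of_ne hic, add_zero, hsupp i hi,
      CharTwo.add_self_eq_zero]
  have hcard : ∑ i, d i = (p.length : ZMod 2) := by
    rw [← card_support_toFinset_of_isCycle hp, huniv]
    simp [hd_one]
  rw [hdsum, ZMod.natCast_eq_one_iff_odd.2 hodd] at hcard
  exact zero_ne_one hcard

theorem comp_swap_mem_of_adj (hA : IsPauliClosed H A) {w u : U} (hwu : H.Adj w u)
    {x : U → ZMod 2} (hx : (x, 0) ∈ A) : (x ∘ Equiv.swap w u, 0) ∈ A := by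
  by_cases hxwu : x w = x u
  · rwa [Equiv.comp_swap_eq_update, hxwu, Function.update_eq_self, ← hxwu,
      Function.update_eq_self]
  have hone : x w + x u = 1 := (zmodTwo_eq_zero_or_one _).resolve_left
    fun h => hxwu (CharTwo.add_eq_zero.1 h)
  set zz : U → ZMod 2 := Pi.single w 1 + Pi.single u 1 with hzz
  have hxz : (x, zz) ∈ A := by
    simpa only [add_zero, zero_add] using
      hA.add_mem hx (hA.zz_mem hwu) (by simpa [dotProduct_add] using hone)
  have hflip : (x + Pi.single w 1 + Pi.single u 1, zz) ∈ A :=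
    hA.add_single_mem (hA.add_single_mem hxz (by simp [hzz, hwu.ne]) 1)
      (by simp [hzz, hwu.ne']) 1
  have hflip_odd : (x + Pi.single w 1 + Pi.single u 1) ⬝ᵥ zz = 1 := by
    simp only [hzz, dotProduct_add, dotProduct_single_one, Pi.add_apply, Pi.single_eq_same,
      Pi.single_eq_of_ne hwu.ne, Pi.single_eq_of_ne hwu.ne', add_zero]
    linear_combination hone + CharTwo.add_self_eq_zero (1 : ZMod 2)
  rw [comp_swap_eq_add_single_add_single, hone]
  simpa only [add_zero, hzz, ZModModule.add_self] using
    hA.add_mem hflip (hA.zz_mem hwu) (by rw [dotProduct_zero, add_zero, ← hzz, hflip_odd])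

theorem comp_swap_mem (hA : IsPauliClosed H A) (hH : H.Connected) (w u : U) {x : U → ZMod 2}
    (hx : (x, 0) ∈ A) : (x ∘ Equiv.swap w u, 0) ∈ A := by
  obtain ⟨p⟩ := hH.preconnected w u
  induction p generalizing x with
  | nil => rwa [Equiv.swap_self]
  | @cons w v u h p ih =>
    by_cases hwu : w = u
    · subst hwu
      rwa [Equiv.swap_self]
    have hmem := hA.comp_swap_mem_of_adj h (ih (hA.comp_swap_mem_of_adj h hx))
    by_cases hvu : v = u
    · subst hvu
      exact hA.comp_swap_mem_of_adj h hx
    rwa [Function.comp_assoc, Function.comp_assoc, ← Equiv.Perm.coe_mul, ← Equiv.Perm.coe_mul,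
      Equiv.swap_comm w v, Equiv.swap_comm v u, ← mul_assoc,
      Equiv.swap_mul_swap_mul_swap (Ne.symm hvu) (Ne.symm hwu)] at hmem

theorem mem_fiberStabilizer (hA : IsPauliClosed H A) {y z : U → ZMod 2} (hy : (y, 0) ∈ A)
    (hzy : z ⬝ᵥ y = 1) : y ∈ fiberStabilizer A z :=
  fun _ hx => hA.add_mem_of_fst_mem hx hy hzy

theorem single_add_single_mem_fiberStabilizer (hA : IsPauliClosed H A) (hH : H.Connected)
    {d : U → ZMod 2} (hd : (d, 0) ∈ A) {c i b : U} (hc : d c = 1) (hi : d i = 1) (hb : d b = 0)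
    (hic : i ≠ c) :
    Pi.single i 1 + Pi.single b 1 ∈ fiberStabilizer A (Pi.single c 1) := by
  have hbc : b ≠ c := by
    rintro rfl
    exact zero_ne_one (hb.symm.trans hc)
  have hdE := hA.mem_fiberStabilizer (z := Pi.single c 1) hd (by simpa using hc)
  have hswapE := hA.mem_fiberStabilizer (z := Pi.single c 1) (hA.comp_swap_mem hH i b hd)
    (by simpa [Equiv.swap_apply_of_ne_of_ne hic.symm hbc.symm] using hc)
  rw [comp_swap_eq_add_single_add_single, hi, hb, add_zero, add_assoc] at hswapE
  simpa only [← add_assoc, ZModModule.add_self, zero_add] using Submodule.add_mem _ hdE hswapE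

theorem fiberStabilizer_single_eq_top (hA : IsPauliClosed H A) (hH : H.Connected)
    {d : U → ZMod 2} (hd : (d, 0) ∈ A) {c b : U} (hc : d c = 1) (hsum : ∑ i, d i = 0)
    (hb : d b = 0) : fiberStabilizer A (Pi.single c 1) = ⊤ := by
  set E := fiberStabilizer A (Pi.single c 1)
  have hdE : d ∈ E := hA.mem_fiberStabilizer hd (by simpa using hc)
  have hcE : Pi.single c 1 ∈ E := hA.mem_fiberStabilizer (hA.x_mem c) (by simp)
  have hzero : ∀ j, d j = 0 → Pi.single j 1 ∈ E := by
    intro j hj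
    -- As `d` has even weight, it is a sum of pairs through `j`.
    have hsum_d : ∑ i, d i • (Pi.single i 1 + Pi.single j 1) = d := by
      simp only [smul_add, Finset.sum_add_distrib, ← Finset.sum_smul, hsum, zero_smul, add_zero]
      simp only [← Pi.single_smul, smul_eq_mul, mul_one, Finset.univ_sum_single]
    have hothers : ∑ i ∈ Finset.univ.erase c, d i • (Pi.single i 1 + Pi.single j 1) ∈ E := by
      refine sum_mem fun i hi => ?_
      obtain hi0 | hi1 := zmodTwo_eq_zero_or_one (d i)
      · rw [hi0, zero_smul]
        exact E.zero_mem
      · exact E.smul_mem _ (hA.single_add_single_mem_fiberStabilizer hH hd hc hi1 hj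
          (Finset.ne_of_mem_erase hi))
    rw [← Finset.sum_erase_add _ _ (Finset.mem_univ c), hc, one_smul] at hsum_d
    have hcj : Pi.single c 1 + Pi.single j 1 ∈ E :=
      (E.add_mem_iff_right hothers).1 (hsum_d.symm ▸ hdE)
    exact (E.add_mem_iff_right hcE).1 hcj
  refine eq_top_of_forall_single_mem fun i => ?_
  obtain hi0 | hi1 := zmodTwo_eq_zero_or_one (d i)
  · exact hzero i hi0
  obtain rfl | hic := eq_or_ne i c
  · exact hcE
  · have hpair := hA.single_add_single_mem_fiberStabilizer hH hd hc hi1 hb hic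
    simpa only [add_assoc, ZModModule.add_self, add_zero] using
      E.add_mem hpair (hzero b hb)

theorem single_mem_of_adj (hA : IsPauliClosed H A) {c u : U} (hcu : H.Adj c u)
    (hc : ∀ x, (x, Pi.single c 1) ∈ A) (x : U → ZMod 2) : (x, Pi.single u 1) ∈ A := by
  have hc' := hA.mem_single_of_adj (hc (x + Pi.single u (x c + x u + 1))) hcu (by
    simp only [Pi.add_apply, Pi.single_eq_same, Pi.single_eq_of_ne hcu.ne, add_zero]
    linear_combination CharTwo.add_self_eq_zero (x c) + CharTwo.add_self_eq_zero (x u))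
  have hx := hA.add_single_mem hc' (Pi.single_eq_same u 1) (x c + x u + 1)
  rwa [add_assoc, ZModModule.add_self, add_zero] at hx

theorem exists_forall_single_mem (hA : IsPauliClosed H A) (hH : H.Connected)
    (hbip : ¬ H.IsBipartite) {r : U} {x : U → ZMod 2} (hr : (x, Pi.single r 1) ∈ A) :
    ∃ c, ∀ y, (y, Pi.single c 1) ∈ A := by
  obtain ⟨c, p, hp, hodd⟩ : ∃ (c : U) (p : H.Walk c c), p.IsCycle ∧ Odd p.length := by
    by_contra! hcycle
    exact hbip (isBipartite_of_forall_isCycle_even_length fun c p hp =>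
      Nat.not_odd_iff_even.1 (hcycle c p hp))
  obtain ⟨q⟩ := hH.preconnected r c
  obtain ⟨x', hx', -⟩ := hA.exists_mem_of_walk q hr
  obtain ⟨d, hd, hdc, hsum, b, hb⟩ := hA.exists_even_x_mem hp hodd hx'
  exact ⟨c, fun y => mem_of_fiberStabilizer_eq_top
    (hA.fiberStabilizer_single_eq_top hH hd hdc hsum hb) hx'⟩

theorem forall_single_mem (hA : IsPauliClosed H A) (hH : H.Connected)
    (hbip : ¬ H.IsBipartite) {r : U} {x : U → ZMod 2} (hr : (x, Pi.single r 1) ∈ A) (u : U)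
    (y : U → ZMod 2) : (y, Pi.single u 1) ∈ A := by
  obtain ⟨c, hc⟩ := hA.exists_forall_single_mem hH hbip hr
  obtain ⟨p⟩ := hH.preconnected c u
  induction p with
  | nil => exact hc y
  | cons h _ ih => exact ih (hA.single_mem_of_adj h hc)

theorem x_mem_of_forall_single_mem (hA : IsPauliClosed H A)
    (hsingle : ∀ u y, (y, Pi.single u 1) ∈ A) {y : U → ZMod 2} (hy : y ≠ 0) : (y, 0) ∈ A := by
  obtain ⟨t, ht⟩ := exists_apply_eq_one hy
  simpa only [add_zero] using hA.add_fst_mem (hsingle t y) (hsingle t 0) (by simpa using ht)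

theorem forall_mem_of_mem (hA : IsPauliClosed H A) (hX : ∀ y : U → ZMod 2, y ≠ 0 → (y, 0) ∈ A)
    {x z : U → ZMod 2} (hx : (x, z) ∈ A) {t : U} (ht : z t = 1) (y : U → ZMod 2) :
    (y, z) ∈ A := by
  refine mem_of_fiberStabilizer_eq_top (eq_top_of_forall_single_mem fun i => ?_) hx
  have htE := hA.mem_fiberStabilizer (z := z) (hA.x_mem t) (by simpa using ht)
  obtain hi | hi := zmodTwo_eq_zero_or_one (z i)
  · have hne : (Pi.single i 1 + Pi.single t 1 : U → ZMod 2) ≠ 0 := by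
      intro h
      have hit : i ≠ t := by
        rintro rfl
        exact zero_ne_one (hi.symm.trans ht)
      simpa [hit] using congrFun h i
    have hpair := hA.mem_fiberStabilizer (z := z) (hX _ hne) (by simp [dotProduct_add, hi, ht])
    simpa only [add_assoc, ZModModule.add_self, add_zero] using Submodule.add_mem _ hpair htE
  · exact hA.mem_fiberStabilizer (hA.x_mem i) (by simpa using hi)

theorem exists_mem_sum_single (hA : IsPauliClosed H A)
    (hsingle : ∀ u y, (y, Pi.single u 1) ∈ A) {s : Finset U} (hs : s.Nonempty) :
    ∃ x : U → ZMod 2, (x, ∑ i ∈ s, Pi.single i 1) ∈ A := by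
  induction hs using Finset.Nonempty.cons_induction with
  | singleton i => exact ⟨0, by simpa using hsingle i 0⟩
  | cons i s hi hs ih =>
    obtain ⟨x, hx⟩ := ih
    obtain ⟨t, ht⟩ := hs
    have hi_mem := hA.forall_mem_of_mem (fun y => hA.x_mem_of_forall_single_mem hsingle) hx
      (t := t) (by simp [Finset.sum_apply, Pi.single_apply, ht]) (Pi.single i 1)
    rw [Finset.sum_cons]
    exact ⟨_, hA.add_mem (hsingle i 0) hi_mem (by simp)⟩

theorem mem_of_ne_zero (hA : IsPauliClosed H A) (hH : H.Connected) (hbip : ¬ H.IsBipartite)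
    {r : U} {x : U → ZMod 2} (hr : (x, Pi.single r 1) ∈ A) {a : (U → ZMod 2) × (U → ZMod 2)}
    (ha : a ≠ 0) : a ∈ A := by
  have hsingle := hA.forall_single_mem hH hbip hr
  have hX : ∀ y : U → ZMod 2, y ≠ 0 → (y, 0) ∈ A :=
    fun y => hA.x_mem_of_forall_single_mem hsingle
  obtain ⟨y, z⟩ := a
  by_cases hz : z = 0
  · subst hz
    exact hX y fun hy => ha (Prod.ext hy rfl)
  · obtain ⟨t, ht⟩ := exists_apply_eq_one hz
    obtain ⟨x', hx'⟩ := hA.exists_mem_sum_single hsingle (s := {i | z i = 1})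
      ⟨t, by simpa using ht⟩
    rw [sum_single_filter_eq_one] at hx'
    exact hA.forall_mem_of_mem hX hx' ht y

end IsPauliClosed

end Labels

section PauliStrings

/-- The sign character `a ↦ (-1)^a`. -/
noncomputable def signChar : AddChar (ZMod 2) ℂ := AddChar.zmodChar 2 (ζ := -1) (by norm_num)

theorem signChar_one : signChar 1 = -1 := by
  rw [signChar, AddChar.zmodChar_apply, ZMod.val_one, pow_one]

theorem signChar_apply (a : ZMod 2) : signChar a = if a = 0 then 1 else -1 := by
  obtain rfl | rfl := zmodTwo_eq_zero_or_one a
  · rw [AddChar.map_zero_eq_one, if_pos rfl]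
  · rw [signChar_one, if_neg one_ne_zero]

theorem star_signChar (a : ZMod 2) : star (signChar a) = signChar a := by
  rw [signChar_apply]
  split_ifs <;> simp

/-- The phase that makes `X^x Z^z` skew-Hermitian, as a function of `x ⬝ᵥ z`. -/
noncomputable def pauliPhase (a : ZMod 2) : ℂ := if a = 0 then Complex.I else 1

theorem pauliPhase_zero : pauliPhase 0 = Complex.I := if_pos rfl

theorem pauliPhase_one : pauliPhase 1 = 1 := if_neg one_ne_zero

theorem pauliPhase_ne_zero (a : ZMod 2) : pauliPhase a ≠ 0 := by
  rw [pauliPhase]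
  split_ifs
  exacts [Complex.I_ne_zero, one_ne_zero]

theorem star_pauliPhase_mul_signChar (a : ZMod 2) :
    star (pauliPhase a) * signChar a = -pauliPhase a := by
  rw [pauliPhase, signChar_apply]
  split_ifs <;> simp

theorem pauliPhase_mul (a b : ZMod 2) : ∃ r : ℝ, r ≠ 0 ∧
    pauliPhase a * pauliPhase b = r * pauliPhase (a + b + 1) := by
  obtain rfl | rfl := zmodTwo_eq_zero_or_one a <;> obtain rfl | rfl := zmodTwo_eq_zero_or_one b
  · exact ⟨-1, by norm_num, by simp [pauliPhase_zero, pauliPhase_one]⟩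
  all_goals
    exact ⟨1, one_ne_zero, by simp [pauliPhase_zero, pauliPhase_one, CharTwo.add_self_eq_zero]⟩

variable {U : Type*}

/-- Bit strings as vectors over the field with two elements. -/
def bits : BitString U ≃ (U → ZMod 2) := Equiv.refl _

theorem eq_add_iff_add_eq {s t x : U → ZMod 2} : s = t + x ↔ s + t = x := by
  rw [← ZModModule.sub_eq_add s t, sub_eq_iff_eq_add']

theorem eq_add_single_iff [DecidableEq U] {s t : U → ZMod 2} {w : U} :
    s = t + Pi.single w 1 ↔ (∀ u, u ≠ w → s u = t u) ∧ s w = t w + 1 := by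
  rw [funext_iff, and_comm]
  refine ⟨fun h => ⟨by simpa using h w, fun u hu => by simpa [hu] using h u⟩, fun h u => ?_⟩
  by_cases hu : u = w
  · subst hu
    simpa using h.1
  · simpa [hu] using h.2 u hu

variable [Fintype U]

/-- The Pauli string `X^x Z^z`, which sends the basis vector `t` to `(-1)^(z ⬝ᵥ t)` times the basis
vector `t + x`. -/
noncomputable def xzString (x z : U → ZMod 2) : QubitOp U :=
  Matrix.of fun s t => if bits s = bits t + x then signChar (z ⬝ᵥ bits t) else 0

/-- The skew-Hermitian Pauli string, a phase times `X^x Z^z`. -/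
noncomputable def skewPauli (x z : U → ZMod 2) : QubitOp U :=
  pauliPhase (x ⬝ᵥ z) • xzString x z

theorem xzString_apply (x z : U → ZMod 2) (s t : BitString U) :
    xzString x z s t = if bits s = bits t + x then signChar (z ⬝ᵥ bits t) else 0 := rfl

theorem conjTranspose_xzString (x z : U → ZMod 2) :
    (xzString x z)ᴴ = signChar (x ⬝ᵥ z) • xzString x z := by
  ext s t
  rw [Matrix.conjTranspose_apply, Matrix.smul_apply, xzString_apply, xzString_apply]
  have hcomm : bits t = bits s + x ↔ bits s = bits t + x := by
    rw [eq_add_iff_add_eq, eq_add_iff_add_eq, add_comm]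
  by_cases h : bits s = bits t + x
  · rw [if_pos (hcomm.2 h), if_pos h, star_signChar, smul_eq_mul, ← AddChar.map_add_eq_mul,
      dotProduct_comm x, ← dotProduct_add, h, add_comm x]
  · rw [if_neg (mt hcomm.1 h), if_neg h, star_zero, smul_zero]

theorem conjTranspose_skewPauli (x z : U → ZMod 2) : (skewPauli x z)ᴴ = -skewPauli x z := by
  rw [skewPauli, Matrix.conjTranspose_smul, conjTranspose_xzString, smul_smul,
    star_pauliPhase_mul_signChar, neg_smul]

theorem xzString_zero_left (z : U → ZMod 2) :
    xzString 0 z = Matrix.diagonal fun t : BitString U => signChar (z ⬝ᵥ bits t) := by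
  ext s t
  simp only [xzString_apply, Matrix.diagonal_apply, add_zero, EmbeddingLike.apply_eq_iff_eq]
  split_ifs with h
  · rw [h]
  · rfl

variable [DecidableEq U]

theorem xzString_mul (x z x' z' : U → ZMod 2) :
    xzString x z * xzString x' z' = signChar (z ⬝ᵥ x') • xzString (x + x') (z + z') := by
  ext s t
  rw [Matrix.mul_apply, Matrix.smul_apply, Finset.sum_eq_single (bits.symm (bits t + x'))]
  · simp only [xzString_apply, Equiv.apply_symm_apply, if_true, smul_eq_mul, dotProduct_add,
      add_dotProduct, AddChar.map_add_eq_mul, add_assoc, add_comm x' x]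
    split_ifs <;> ring
  · intro r _ hr
    rw [xzString_apply x' z' r t, if_neg, mul_zero]
    rwa [Ne, Equiv.eq_symm_apply] at hr
  · simp

theorem sum_signChar_dotProduct (z : U → ZMod 2) :
    ∑ t : U → ZMod 2, signChar (z ⬝ᵥ t) = if z = 0 then (2 : ℂ) ^ Fintype.card U else 0 := by
  split_ifs with hz
  · simp [hz]
  · obtain ⟨k, hk⟩ := exists_apply_eq_one hz
    set χ := signChar.compAddMonoidHom (AddMonoidHom.mk' (z ⬝ᵥ ·) (dotProduct_add z)) with hχ
    have hχk : χ (Pi.single k 1) = -1 := by simp [hχ, hk, signChar_one]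
    refine AddChar.sum_eq_zero_of_ne_one (ψ := χ) fun h => ?_
    rw [h, AddChar.one_apply] at hχk
    norm_num at hχk

theorem trace_xzString {x z : U → ZMod 2} (h : (x, z) ≠ 0) : (xzString x z).trace = 0 := by
  simp only [Matrix.trace, Matrix.diag_apply, xzString_apply, left_eq_add]
  split_ifs with hx
  · rw [bits.sum_comp fun t => signChar (z ⬝ᵥ t), sum_signChar_dotProduct, if_neg]
    exact fun hz => h (Prod.ext hx hz)
  · exact Finset.sum_const_zero

theorem skewPauli_mem_su {x z : U → ZMod 2} (h : (x, z) ≠ 0) :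
    skewPauli x z ∈ su (BitString U) :=
  ⟨conjTranspose_skewPauli x z, by rw [skewPauli, Matrix.trace_smul, trace_xzString h, smul_zero]⟩

theorem lie_skewPauli (x z x' z' : U → ZMod 2) :
    ⁅skewPauli x z, skewPauli x' z'⁆ = (pauliPhase (x ⬝ᵥ z) * pauliPhase (x' ⬝ᵥ z') *
      (signChar (z ⬝ᵥ x') - signChar (x ⬝ᵥ z'))) • xzString (x + x') (z + z') := by
  rw [Ring.lie_def, skewPauli, skewPauli, Matrix.smul_mul, Matrix.mul_smul, Matrix.smul_mul,
    Matrix.mul_smul, xzString_mul, xzString_mul, add_comm x' x, add_comm z' z,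
    dotProduct_comm z' x]
  simp only [smul_smul, ← sub_smul]
  congr 1
  ring

theorem lie_skewPauli_of_commute {x z x' z' : U → ZMod 2} (h : x ⬝ᵥ z' + z ⬝ᵥ x' = 0) :
    ⁅skewPauli x z, skewPauli x' z'⁆ = 0 := by
  rw [lie_skewPauli, CharTwo.add_eq_zero.1 h, sub_self, mul_zero, zero_smul]

theorem lie_skewPauli_of_anticommute {x z x' z' : U → ZMod 2} (h : x ⬝ᵥ z' + z ⬝ᵥ x' = 1) :
    ∃ r : ℝ, r ≠ 0 ∧ ⁅skewPauli x z, skewPauli x' z'⁆ = r • skewPauli (x + x') (z + z') := by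
  obtain ⟨r, hr, hphase⟩ := pauliPhase_mul (x ⬝ᵥ z) (x' ⬝ᵥ z')
  obtain ⟨q, hq, hsign⟩ : ∃ q : ℝ, q ≠ 0 ∧ signChar (z ⬝ᵥ x') - signChar (x ⬝ᵥ z') = q := by
    rw [eq_sub_of_add_eq h]
    obtain h0 | h0 := zmodTwo_eq_zero_or_one (z ⬝ᵥ x')
    · exact ⟨2, two_ne_zero, by norm_num [h0, signChar_one]⟩
    · exact ⟨-2, by norm_num, by norm_num [h0, signChar_one]⟩
  have hdot : (x + x') ⬝ᵥ (z + z') = x ⬝ᵥ z + x' ⬝ᵥ z' + 1 := by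
    rw [dotProduct_add, add_dotProduct, add_dotProduct, dotProduct_comm x' z, ← h]
    ring
  refine ⟨r * q, mul_ne_zero hr hq, ?_⟩
  rw [lie_skewPauli, skewPauli, hdot, hphase, hsign, ← Complex.coe_smul, smul_smul,
    Complex.ofReal_mul, mul_right_comm]

theorem skewPauli_add_mem {g : LieSubalgebra ℝ (QubitOp U)} {x z x' z' : U → ZMod 2}
    (hmem : ⁅skewPauli x z, skewPauli x' z'⁆ ∈ g) (h : x ⬝ᵥ z' + z ⬝ᵥ x' = 1) :
    skewPauli (x + x') (z + z') ∈ g := by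
  obtain ⟨r, hr, hlie⟩ := lie_skewPauli_of_anticommute h
  rw [hlie] at hmem
  exact (g.toSubmodule.smul_mem_iff hr).1 hmem

theorem xzString_single_zero (w : U) : xzString (Pi.single w 1) 0 = pauliX w := by
  have hX : ∀ a b : ZMod 2, (if a = b + 1 then (1 : ℂ) else 0) =
      (!![0, 1; 1, 0] : Matrix (Fin 2) (Fin 2) ℂ) a b := by
    intro a b
    fin_cases a <;> fin_cases b <;> rfl
  ext s t
  rw [xzString_apply, zero_dotProduct, AddChar.map_zero_eq_one]
  simp only [eq_add_single_iff, ite_and, hX]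
  rfl

theorem skewPauli_single_zero (w : U) : skewPauli (Pi.single w 1) 0 = Complex.I • pauliX w := by
  rw [skewPauli, dotProduct_zero, pauliPhase_zero, xzString_single_zero]

theorem xzString_zero_single (w : U) : xzString 0 (Pi.single w 1) = pauliZ w := by
  rw [xzString_zero_left, pauliZ_eq_diagonal]
  congr 1
  funext t
  rw [single_dotProduct, one_mul, signChar_apply]
  rfl

theorem skewPauli_zero_single (w : U) : skewPauli 0 (Pi.single w 1) = Complex.I • pauliZ w := by
  rw [skewPauli, zero_dotProduct, pauliPhase_zero, xzString_zero_single]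

theorem skewPauli_zero_single_add_single (w u : U) :
    skewPauli 0 (Pi.single w 1 + Pi.single u 1) = Complex.I • pauliZZ s(w, u) := by
  have hmul := xzString_mul 0 (Pi.single w 1) 0 (Pi.single u 1 : U → ZMod 2)
  rw [dotProduct_zero, AddChar.map_zero_eq_one, one_smul, add_zero, xzString_zero_single,
    xzString_zero_single] at hmul
  rw [skewPauli, zero_dotProduct, pauliPhase_zero, ← hmul]
  rfl

theorem sum_signChar_smul_xzString (s t : BitString U) :
    ∑ z, signChar (z ⬝ᵥ bits t) • xzString (bits s + bits t) z =
      (2 : ℂ) ^ Fintype.card U • Matrix.single s t 1 := by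
  ext s' t'
  have hsign : ∀ z, signChar (z ⬝ᵥ bits t) * signChar (z ⬝ᵥ bits t') =
      signChar ((bits t + bits t') ⬝ᵥ z) := fun z => by
    rw [← AddChar.map_add_eq_mul, ← dotProduct_add, dotProduct_comm]
  have hindex : bits s' = bits t' + (bits s + bits t) ↔ bits s + bits t = bits s' + bits t' := by
    rw [eq_add_iff_add_eq, eq_comm]
  simp only [Matrix.sum_apply, Matrix.smul_apply, xzString_apply, smul_eq_mul, mul_ite, mul_zero,
    mul_one, hsign, hindex, Matrix.single_apply]
  by_cases ht : t = t'
  · subst ht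
    simp [ZModModule.add_self]
  · have hne : bits t + bits t' ≠ 0 := fun h =>
      ht (bits.injective (by rwa [← eq_add_iff_add_eq, add_zero] at h))
    rw [if_neg fun h => ht h.2]
    split_ifs
    · rw [sum_signChar_dotProduct, if_neg hne]
    · exact Finset.sum_const_zero

end PauliStrings

section SkewSpan

variable {E : Type*} [AddCommGroup E] [Module ℂ E] [StarAddMonoid E] [StarModule ℂ E] {S : Set E}

theorem sub_star_mem_span_real (hS : ∀ P ∈ S, star P = -P) {M : E}
    (hM : M ∈ Submodule.span ℂ S) : M - star M ∈ Submodule.span ℝ S := by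
  induction hM using Submodule.closure_induction with
  | zero => simp
  | add M N _ _ hM hN =>
    rw [star_add, add_sub_add_comm]
    exact add_mem hM hN
  | smul_mem c P hP =>
    have hre : c • P - star (c • P) = (2 * c.re) • P := by
      rw [star_smul, hS P hP, smul_neg, sub_neg_eq_add, ← add_smul, ← starRingEnd_apply,
        Complex.add_conj, Complex.coe_smul]
    rw [hre]
    exact Submodule.smul_mem _ _ (Submodule.subset_span hP)

theorem mem_span_real_of_star_eq_neg (hS : ∀ P ∈ S, star P = -P) {M : E}
    (hM : M ∈ Submodule.span ℂ S) (hskew : star M = -M) : M ∈ Submodule.span ℝ S := by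
  have hdouble := sub_star_mem_span_real hS hM
  rw [hskew, sub_neg_eq_add, ← two_smul ℝ] at hdouble
  exact (Submodule.smul_mem_iff _ two_ne_zero).1 hdouble

end SkewSpan

section SpecialUnitary

variable {U : Type*} [Fintype U]

theorem skewPauli_zero_zero : (skewPauli 0 0 : QubitOp U) = Complex.I • 1 := by
  rw [skewPauli, zero_dotProduct, pauliPhase_zero, xzString_zero_left]
  simp

theorem span_complex_range_skewPauli :
    Submodule.span ℂ (Set.range (Function.uncurry (skewPauli (U := U)))) = ⊤ := by
  classical
  set S := Submodule.span ℂ (Set.range (Function.uncurry (skewPauli (U := U))))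
  have hxz : ∀ x z : U → ZMod 2, xzString x z ∈ S := fun x z =>
    (S.smul_mem_iff (pauliPhase_ne_zero _)).1 (Submodule.subset_span ⟨(x, z), rfl⟩)
  have hunit : ∀ s t : BitString U, Matrix.single s t (1 : ℂ) ∈ S := fun s t => by
    have h2 : (2 : ℂ) ^ Fintype.card U ≠ 0 := pow_ne_zero _ two_ne_zero
    rw [← S.smul_mem_iff h2, ← sum_signChar_smul_xzString]
    exact sum_mem fun z _ => S.smul_mem _ (hxz _ z)
  refine eq_top_iff.2 fun B _ => ?_
  rw [Matrix.matrix_eq_sum_single B]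
  refine sum_mem fun s _ => sum_mem fun t _ => ?_
  rw [← mul_one (B s t), ← smul_eq_mul, ← Matrix.smul_single]
  exact S.smul_mem _ (hunit s t)

variable [DecidableEq U]

theorem su_le_of_skewPauli_mem {g : LieSubalgebra ℝ (QubitOp U)}
    (hg : ∀ x z : U → ZMod 2, (x, z) ≠ 0 → skewPauli x z ∈ g) : su (BitString U) ≤ g := by
  rintro B ⟨hskew, htrace⟩
  have hB : B ∈ Submodule.span ℝ (Set.range (Function.uncurry (skewPauli (U := U)))) := by
    refine mem_span_real_of_star_eq_neg ?_ (Submodule.eq_top_iff'.1 span_complex_range_skewPauli B)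
      hskew
    rintro _ ⟨a, rfl⟩
    exact conjTranspose_skewPauli _ _
  have hrange : Set.range (Function.uncurry (skewPauli (U := U))) ⊆
      insert (skewPauli 0 0) (su (BitString U) ⊓ g : LieSubalgebra ℝ (QubitOp U)) := by
    rintro _ ⟨⟨x, z⟩, rfl⟩
    by_cases h : (x, z) = 0
    · obtain ⟨rfl, rfl⟩ := Prod.mk_eq_zero.1 h
      exact Set.mem_insert _ _
    · exact Set.mem_insert_of_mem _ ⟨skewPauli_mem_su h, hg x z h⟩
  obtain ⟨r, C, hC, rfl⟩ := Submodule.mem_span_insert.1 (Submodule.span_mono hrange hB)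
  have hC : C ∈ su (BitString U) ⊓ g :=
    (Submodule.span_le (p := (su (BitString U) ⊓ g).toSubmodule)).2 (fun _ h => h) hC
  have hr : r = 0 := by
    rw [Matrix.trace_add, hC.1.2, skewPauli_zero_zero, Matrix.trace_smul, Matrix.trace_smul,
      Matrix.trace_one] at htrace
    simpa using htrace
  rw [hr, zero_smul, zero_add]
  exact hC.2

variable {ι κ : Type*} [Fintype ι] [DecidableEq ι] [Fintype κ] [DecidableEq κ]

theorem reindex_mem_su (e : ι ≃ κ) {B : Matrix ι ι ℂ} (hB : B ∈ su ι) :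
    Matrix.reindex e e B ∈ su κ := by
  refine ⟨?_, (e.symm.sum_comp fun i => B i i).trans hB.2⟩
  rw [Matrix.conjTranspose_reindex, hB.1]
  rfl

/-- The isomorphism of the Lie algebras `su` induced by a bijection of orthonormal bases. -/
noncomputable def suEquivOfEquiv (e : ι ≃ κ) : su ι ≃ₗ⁅ℝ⁆ su κ :=
  LieEquiv.ofSubalgebras (su ι) (su κ) (Matrix.reindexAlgEquiv ℝ ℂ e).toLieEquiv <| by
    refine le_antisymm ?_ fun B hB => ?_
    · rintro _ ⟨B, hB, rfl⟩
      exact reindex_mem_su e hB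
    · exact ⟨_, reindex_mem_su e.symm hB, (Matrix.reindexAlgEquiv ℝ ℂ e).apply_symm_apply B⟩

end SpecialUnitary

section DynamicalLieAlgebras

section Free

variable {U : Type*} [Fintype U] [DecidableEq U] {g : LieSubalgebra ℝ (QubitOp U)}

theorem isPauliClosed_of_freeDLA_le {H : SimpleGraph U} (hg : freeDLA H ≤ g) :
    IsPauliClosed H {a | skewPauli a.1 a.2 ∈ g} where
  add_mem ha ha' h := skewPauli_add_mem (g.lie_mem ha ha') h
  x_mem w := hg (LieSubalgebra.subset_lieSpan (Or.inl ⟨w, skewPauli_single_zero w⟩))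
  zz_mem {w u} hwu :=
    hg (LieSubalgebra.subset_lieSpan (Or.inr ⟨s(w, u), hwu, skewPauli_zero_single_add_single w u⟩))

theorem skewPauli_zero_single_mem_of_sum_mem {w : U} (hX : skewPauli (Pi.single w 1) 0 ∈ g)
    {T : Finset U} (hw : w ∈ T) (hsum : ∑ u ∈ T, skewPauli 0 (Pi.single u 1) ∈ g) :
    skewPauli 0 (Pi.single w 1) ∈ g := by
  have hlie := g.lie_mem hX hsum
  rw [lie_sum, Finset.sum_eq_single_of_mem w hw fun u _ hu =>
    lie_skewPauli_of_commute (by simp [hu.symm])] at hlie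
  have hxz := skewPauli_add_mem hlie (by simp)
  have hz := skewPauli_add_mem (g.lie_mem hxz hX) (by simp)
  simpa only [add_zero, zero_add, ZModModule.add_self] using hz

end Free

variable {V : Type*} [Fintype V] [DecidableEq V] (G : SimpleGraph V) (v : V)

theorem freeReducedDLA_le_su : freeReducedDLA G v ≤ su (BitString {w : V // w ≠ v}) := by
  refine LieSubalgebra.lieSpan_le.2 ?_
  rintro B ((⟨w, rfl⟩ | ⟨e, he, rfl⟩) | ⟨w, -, rfl⟩)
  · rw [← skewPauli_single_zero]
    exact skewPauli_mem_su (by simp)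
  · induction e with
    | _ w u =>
      rw [← skewPauli_zero_single_add_single]
      refine skewPauli_mem_su fun h => ?_
      have hw := congrFun (Prod.mk_eq_zero.1 h).2 w
      have hne : w ≠ u := SimpleGraph.Adj.ne ((reducedGraph G v).mem_edgeSet.1 he)
      simp [hne] at hw
  · rw [← skewPauli_zero_single]
    exact skewPauli_mem_su (by simp)

theorem freeDLA_le_freeReducedDLA : freeDLA (reducedGraph G v) ≤ freeReducedDLA G v :=
  LieSubalgebra.lieSpan_mono Set.subset_union_left

variable {G v}

theorem freeReducedDLA_eq_su (hG : G.Connected) (hconn : (reducedGraph G v).Connected)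
    (hbip : ¬ (reducedGraph G v).IsBipartite) :
    freeReducedDLA G v = su (BitString {w : V // w ≠ v}) := by
  refine le_antisymm (freeReducedDLA_le_su G v) (su_le_of_skewPauli_mem fun x z hxz => ?_)
  obtain ⟨u⟩ := hconn.nonempty
  have : Nontrivial V := ⟨u.1, v, u.2⟩
  obtain ⟨r, hr⟩ := hG.preconnected.exists_adj_of_nontrivial v
  have hz : skewPauli 0 (Pi.single (⟨r, hr.ne'⟩ : {w : V // w ≠ v}) 1) ∈ freeReducedDLA G v := by
    rw [skewPauli_zero_single]
    exact LieSubalgebra.subset_lieSpan (Or.inr ⟨⟨r, hr.ne'⟩, hr, rfl⟩)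
  exact (isPauliClosed_of_freeDLA_le (freeDLA_le_freeReducedDLA G v)).mem_of_ne_zero hconn hbip
    (a := (x, z)) hz hxz

variable [DecidableRel G.Adj]

theorem stdReducedDLA_le_freeReducedDLA : stdReducedDLA G v ≤ freeReducedDLA G v := by
  refine LieSubalgebra.lieSpan_le.2 ?_
  rintro B (rfl | rfl)
  · rw [reducedMixer, Finset.smul_sum]
    exact sum_mem fun w _ => LieSubalgebra.subset_lieSpan (Or.inl (Or.inl ⟨w, rfl⟩))
  · rw [reducedProblem, smul_add, Finset.smul_sum, Finset.smul_sum]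
    refine add_mem (sum_mem fun e he => ?_) (sum_mem fun w hw => ?_)
    · exact LieSubalgebra.subset_lieSpan
        (Or.inl (Or.inr ⟨e, SimpleGraph.mem_edgeFinset.1 he, rfl⟩))
    · exact LieSubalgebra.subset_lieSpan (Or.inr ⟨w, (Finset.mem_filter.1 hw).2, rfl⟩)

theorem pauliZ_mem_stdReducedDLA (hcontain : freeDLA (reducedGraph G v) ≤ stdReducedDLA G v)
    {w : {w : V // w ≠ v}} (hw : G.Adj v w.1) : Complex.I • pauliZ w ∈ stdReducedDLA G v := by
  have hproblem : Complex.I • reducedProblem G v ∈ stdReducedDLA G v :=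
    LieSubalgebra.subset_lieSpan (Or.inr rfl)
  have hedges : ∑ e ∈ (reducedGraph G v).edgeFinset, Complex.I • pauliZZ e ∈ stdReducedDLA G v :=
    sum_mem fun e he => hcontain (LieSubalgebra.subset_lieSpan
      (Or.inr ⟨e, SimpleGraph.mem_edgeFinset.1 he, rfl⟩))
  rw [reducedProblem, smul_add, Finset.smul_sum, Finset.smul_sum, add_mem_cancel_left hedges]
    at hproblem
  simp only [← skewPauli_zero_single] at hproblem ⊢
  exact skewPauli_zero_single_mem_of_sum_mem ((isPauliClosed_of_freeDLA_le hcontain).x_mem w)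
    (by simpa using hw) hproblem

theorem freeReducedDLA_le_stdReducedDLA
    (hcontain : freeDLA (reducedGraph G v) ≤ stdReducedDLA G v) :
    freeReducedDLA G v ≤ stdReducedDLA G v := by
  refine LieSubalgebra.lieSpan_le.2 (Set.union_subset
    (fun B hB => hcontain (LieSubalgebra.subset_lieSpan hB)) ?_)
  rintro B ⟨w, hw, rfl⟩
  exact pauliZ_mem_stdReducedDLA hcontain hw

end DynamicalLieAlgebras

theorem mainTheorem4_general {V : Type*} [Fintype V] [DecidableEq V] (G : SimpleGraph V)
    [DecidableRel G.Adj] (v : V) (hG : G.Connected)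
    (hconn : (reducedGraph G v).Connected)
    (hbip : ¬ (reducedGraph G v).IsBipartite)
    (hcontain : freeDLA (reducedGraph G v) ≤ stdReducedDLA G v) :
    stdReducedDLA G v = freeReducedDLA G v ∧
      Nonempty (stdReducedDLA G v ≃ₗ⁅ℝ⁆ su (BitString {w : V // w ≠ v})) ∧
      Nonempty (su (BitString {w : V // w ≠ v}) ≃ₗ⁅ℝ⁆ su (Fin (2 ^ (Fintype.card V - 1)))) := by
  have hfree : stdReducedDLA G v = freeReducedDLA G v :=
    le_antisymm stdReducedDLA_le_freeReducedDLA (freeReducedDLA_le_stdReducedDLA hcontain)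
  have hsu : stdReducedDLA G v = su (BitString {w : V // w ≠ v}) :=
    hfree.trans (freeReducedDLA_eq_su hG hconn hbip)
  have hcard : Fintype.card (BitString {w : V // w ≠ v}) = 2 ^ (Fintype.card V - 1) := by
    rw [Fintype.card_fun, Fintype.card_fin, Fintype.card_subtype_compl, Fintype.card_subtype_eq]
  exact ⟨hfree, ⟨LieEquiv.ofEq _ _ (congrArg _ hsu)⟩,
    ⟨suEquivOfEquiv (Fintype.equivFinOfCardEq hcard)⟩⟩

theorem mainTheorem4 {V : Type*} [Fintype V] [DecidableEq V] (G : SimpleGraph V)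
    [DecidableRel G.Adj] (v : V) (hG : G.Connected)
    (hconn : (reducedGraph G v).Connected)
    (hbip : ¬ (reducedGraph G v).IsBipartite)
    (hcycle : ¬ IsCycleGraph (reducedGraph G v))
    (hcontain : freeDLA (reducedGraph G v) ≤ stdReducedDLA G v) :
    stdReducedDLA G v = freeReducedDLA G v ∧
      Nonempty (stdReducedDLA G v ≃ₗ⁅ℝ⁆ su (BitString {w : V // w ≠ v})) ∧
      Nonempty (su (BitString {w : V // w ≠ v}) ≃ₗ⁅ℝ⁆ su (Fin (2 ^ (Fintype.card V - 1)))) :=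
  mainTheorem4_general G v hG hconn hbip hcontain
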